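/- Let $n\ge 1$. For a unit vector $u\in S^{n-1}$ and a compact set $K\subset\mathbb{R}^n$, let $S_uK$ denote the Steiner symmetral of $K$ along $u$: for each $y\in u^\perp$, if the line $\ell_y=y+\mathbb{R}u$ meets $K$, then $\ell_y\cap S_uK$ is the closed segment of $\ell_y$ centered at $y$ whose length is the one-dimensional Lebesgue measure of $\ell_y\cap K$ (the single point $y$ if that measure is zero); if $\ell_y$ does not meet $K$, then it does not meet $S_uK$. **Theorem 2.1.** Let $(u_m)_{m\ge 1}$ be a sequence in $S^{n-1}$ with $u_{m-1}\cdot u_m=\cos\alpha_m$ for all $m\ge 2$, where $\alpha_m\in(0,\pi/2)$ and $\sum_{m}\alpha_m^2<\infty$. Then there is a sequence of rotations $R_m\in SO(n)$, depending only on $(u_m)$, such that for every nonempty compact set $K\subset\mathbb{R}^n$ there is a nonempty compact set $L\subset\mathbb{R}^n$ for which the sets $$K_m=R_m S_{u_m}\cdots S_{u_1}K$$ converge to $L$ in Hausdorff distance and, moreover, $$\lim_{m\to\infty}\lambda_n(K_m\,\triangle\,L)=0,$$ where $\lambda_n$ is $n$-dimensional Lebesgue measure and $\triangle$ denotes symmetric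 difference. -/

import Mathlib

open scoped Topology symmDiff InnerProductSpace

/-- The foot `y` of `x` on the hyperplane orthogonal to the unit vector `u`: the line through `x`
parallel to `u` is `{y + s u}`. -/
noncomputable def hyperplaneFoot {n : ℕ} (u x : EuclideanSpace ℝ (Fin n)) :
    EuclideanSpace ℝ (Fin n) :=
  x - ⟪u, x⟫_ℝ • u

/-- The intersection of `K` with the line through `y` parallel to the unit vector `u`, in the
arc length parametrization `s ↦ y + s u` of that line. -/
def lineSection {n : ℕ} (u y : EuclideanSpace ℝ (Fin n)) (K : Set (EuclideanSpace ℝ (Fin n))) :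
    Set ℝ :=
  {s : ℝ | y + s • u ∈ K}

/-- The Steiner symmetral of `K` along the unit vector `u`. A line orthogonal to the hyperplane
`uᗮ` through `y ∈ uᗮ` that meets `K` meets the symmetral in the closed segment centred at `y` of
length the one-dimensional Lebesgue measure of its intersection with `K` (a single point if that
measure is zero); a line that does not meet `K` does not meet the symmetral. -/
def steinerSymmetral {n : ℕ} (u : EuclideanSpace ℝ (Fin n))
    (K : Set (EuclideanSpace ℝ (Fin n))) : Set (EuclideanSpace ℝ (Fin n)) :=
  {x | (lineSection u (hyperplaneFoot u x) K).Nonempty ∧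
    ENNReal.ofReal (2 * |⟪u, x⟫_ℝ|) ≤
      MeasureTheory.volume (lineSection u (hyperplaneFoot u x) K)}

/-- The iterated symmetral of `K` along `u 1`, then `u 2`, ..., then `u m`; the sequence of
directions is indexed from `1`. -/
def iteratedSymmetral {n : ℕ} (u : ℕ → EuclideanSpace ℝ (Fin n))
    (K : Set (EuclideanSpace ℝ (Fin n))) : ℕ → Set (EuclideanSpace ℝ (Fin n))
  | 0 => K
  | m + 1 => steinerSymmetral (u (m + 1)) (iteratedSymmetral u K m)

/-- A linear isometry of `ℝⁿ` that preserves orientation. -/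
def IsRotation {n : ℕ} (R : EuclideanSpace ℝ (Fin n) ≃ₗᵢ[ℝ] EuclideanSpace ℝ (Fin n)) : Prop :=
  LinearMap.det (R.toLinearEquiv : EuclideanSpace ℝ (Fin n) →ₗ[ℝ] EuclideanSpace ℝ (Fin n)) = 1

/-!
Each `R m` is composed of the plane rotations taking a direction to its predecessor, so that all the
aligned symmetrals `R m '' iteratedSymmetral u K m` are symmetrized along the first direction `u 1`.
Passing from one to the next means tilting by a small angle `α` and symmetrizing again.

*Hausdorff convergence.* Suppose that a late aligned symmetral misses a ball around `x`. Its sections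
along `u 1` are centred segments (or points), so it also misses everything beyond the ball, and hence
lies below a steep paraboloid with axis `u 1` whose vertex lies a little below `x`, and above the
mirror image of that paraboloid. Tilting and symmetrizing respects such a region up to raising it by
`O(α ^ 2)`: to first order in `α` the two ends of a section move by the same amount in the same
direction, and the symmetrization recentres it
(`exists_steinerSymmetral_subset_paraboloidRegion`). Since the squares of the angles are summable, the
barrier holds for ever after, and every later symmetral misses a neighbourhood of `x`
(`exists_forall_le_dist_aligned_iteratedSymmetral`). So a point that is approached infinitely often
is approached all the time, which by compactness gives a Hausdorff limit `L`
(`exists_tendsto_hausdorffEDist_of_forall_le_dist`).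

*Convergence in volume.* Symmetrization preserves the volume of compact sets
(`volume_steinerSymmetral`), and the `δ`-parallel set of a symmetral is contained in the symmetral of
the `δ`-parallel set (`cthickening_steinerSymmetral_subset`). Hence the part of `L` outside a late
symmetral has at most the volume gained in passing from `K` to its `δ`-parallel set, and the part of
the symmetral outside `L` at most the volume gained in passing from `L` to its `δ`-parallel set; both
tend to zero with `δ` (`tendsto_measure_symmDiff_of_tendsto_hausdorffEDist`).
-/

open MeasureTheory Set Filter Metric

/-! ### Lines, feet and sections -/

section Foot

variable {n : ℕ} {u : EuclideanSpace ℝ (Fin n)}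

theorem hyperplaneFoot_add (x y : EuclideanSpace ℝ (Fin n)) :
    hyperplaneFoot u (x + y) = hyperplaneFoot u x + hyperplaneFoot u y := by
  simp only [hyperplaneFoot, inner_add_right, add_smul]; abel

theorem hyperplaneFoot_sub (x y : EuclideanSpace ℝ (Fin n)) :
    hyperplaneFoot u (x - y) = hyperplaneFoot u x - hyperplaneFoot u y := by
  simp only [hyperplaneFoot, inner_sub_right, sub_smul]; abel

theorem hyperplaneFoot_add_inner_smul (x : EuclideanSpace ℝ (Fin n)) :
    hyperplaneFoot u x + ⟪u, x⟫_ℝ • u = x := by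
  simp [hyperplaneFoot]

theorem inner_hyperplaneFoot (hu : ‖u‖ = 1) (x : EuclideanSpace ℝ (Fin n)) :
    ⟪u, hyperplaneFoot u x⟫_ℝ = 0 := by
  simp [hyperplaneFoot, inner_sub_right, inner_smul_right, hu]

theorem inner_add_smul (hu : ‖u‖ = 1) {y : EuclideanSpace ℝ (Fin n)} (hy : ⟪u, y⟫_ℝ = 0) (s : ℝ) :
    ⟪u, y + s • u⟫_ℝ = s := by
  simp [inner_add_right, inner_smul_right, hu, hy]

theorem hyperplaneFoot_add_smul (hu : ‖u‖ = 1) {y : EuclideanSpace ℝ (Fin n)}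
    (hy : ⟪u, y⟫_ℝ = 0) (s : ℝ) : hyperplaneFoot u (y + s • u) = y := by
  rw [hyperplaneFoot, inner_add_smul hu hy]; simp

theorem norm_add_smul_sq (hu : ‖u‖ = 1) {y : EuclideanSpace ℝ (Fin n)}
    (hy : ⟪u, y⟫_ℝ = 0) (s : ℝ) : ‖y + s • u‖ ^ 2 = ‖y‖ ^ 2 + s ^ 2 := by
  rw [norm_add_sq_real, inner_smul_right, real_inner_comm, hy, norm_smul, hu]
  simp

theorem norm_sq_eq_hyperplaneFoot (hu : ‖u‖ = 1) (x : EuclideanSpace ℝ (Fin n)) :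
    ‖x‖ ^ 2 = ‖hyperplaneFoot u x‖ ^ 2 + ⟪u, x⟫_ℝ ^ 2 := by
  rw [← norm_add_smul_sq hu (inner_hyperplaneFoot hu x), hyperplaneFoot_add_inner_smul]

theorem norm_hyperplaneFoot_le (hu : ‖u‖ = 1) (x : EuclideanSpace ℝ (Fin n)) :
    ‖hyperplaneFoot u x‖ ≤ ‖x‖ := by
  have := norm_sq_eq_hyperplaneFoot hu x
  exact (sq_le_sq₀ (norm_nonneg _) (norm_nonneg _)).1 (by nlinarith [sq_nonneg ⟪u, x⟫_ℝ])

theorem abs_inner_le_norm_of_unit (hu : ‖u‖ = 1) (x : EuclideanSpace ℝ (Fin n)) :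
    |⟪u, x⟫_ℝ| ≤ ‖x‖ := by
  simpa [hu] using abs_real_inner_le_norm u x

theorem continuous_hyperplaneFoot : Continuous (hyperplaneFoot u) := by
  unfold hyperplaneFoot; fun_prop

theorem isometry_add_smul (hu : ‖u‖ = 1) (y : EuclideanSpace ℝ (Fin n)) :
    Isometry fun s : ℝ => y + s • u := by
  refine Isometry.of_dist_eq fun s t => ?_
  rw [dist_add_left, dist_eq_norm, ← sub_smul, norm_smul, hu, mul_one, Real.dist_eq,
    Real.norm_eq_abs]

theorem isCompact_lineSection (hu : ‖u‖ = 1) (y : EuclideanSpace ℝ (Fin n))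
    {K : Set (EuclideanSpace ℝ (Fin n))} (hK : IsCompact K) : IsCompact (lineSection u y K) :=
  (isometry_add_smul hu y).isClosedEmbedding.isCompact_preimage hK

/-- Nearby lines meet a compact set only near where the given line does. -/
theorem eventually_lineSection_subset (hu : ‖u‖ = 1) {K : Set (EuclideanSpace ℝ (Fin n))}
    (hK : IsCompact K) (y₀ : EuclideanSpace ℝ (Fin n)) {U : Set ℝ} (hU : IsOpen U)
    (h : lineSection u y₀ K ⊆ U) : ∀ᶠ y in 𝓝 y₀, lineSection u y K ⊆ U := by
  obtain ⟨r, hr⟩ := hK.isBounded.subset_closedBall 0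
  set M := r + (‖y₀‖ + 1)
  have h1 : ∀ᶠ y in 𝓝 y₀, ∀ s ∈ Icc (-M) M, y + s • u ∈ K → s ∈ U := by
    refine isCompact_Icc.eventually_forall_of_forall_eventually fun s _ => ?_
    by_cases hs : s ∈ U
    · filter_upwards [continuous_snd.continuousAt.preimage_mem_nhds (hU.mem_nhds hs)]
        with z hz _ using hz
    · have hs' : y₀ + s • u ∈ Kᶜ := fun hk => hs (h hk)
      have hc : Continuous fun z : EuclideanSpace ℝ (Fin n) × ℝ => z.1 + z.2 • u := by fun_prop
      filter_upwards [hc.continuousAt.preimage_mem_nhds (x := (y₀, s))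
        (hK.isClosed.isOpen_compl.mem_nhds hs')] with z hz hz' using absurd hz' hz
  have h2 : ∀ᶠ y in 𝓝 y₀, ‖y‖ < ‖y₀‖ + 1 :=
    continuous_norm.continuousAt.eventually_lt continuousAt_const (by simp)
  filter_upwards [h1, h2] with y hy1 hy2 s hs
  refine hy1 s ?_ hs
  rw [mem_Icc, ← abs_le]
  have h3 : ‖y + s • u‖ ≤ r := by simpa using hr hs
  have h4 : ‖s • u‖ ≤ ‖y + s • u‖ + ‖y‖ := by
    simpa using norm_sub_le (y + s • u) y
  rw [norm_smul, hu, mul_one, Real.norm_eq_abs] at h4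
  linarith

end Foot

/-! ### Steiner symmetrals of compact sets -/

section Steiner

variable {n : ℕ} {u : EuclideanSpace ℝ (Fin n)} {K : Set (EuclideanSpace ℝ (Fin n))}

theorem add_smul_mem_steinerSymmetral (hu : ‖u‖ = 1) {y : EuclideanSpace ℝ (Fin n)}
    (hy : ⟪u, y⟫_ℝ = 0) (s : ℝ) :
    y + s • u ∈ steinerSymmetral u K ↔ (lineSection u y K).Nonempty ∧
      ENNReal.ofReal (2 * |s|) ≤ volume (lineSection u y K) := by
  simp only [steinerSymmetral, mem_ofPred_eq, hyperplaneFoot_add_smul hu hy, inner_add_smul hu hy]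

theorem steinerSymmetral_mono {K' : Set (EuclideanSpace ℝ (Fin n))} (h : K ⊆ K') :
    steinerSymmetral u K ⊆ steinerSymmetral u K' := fun _ hx =>
  have h' : ∀ y, lineSection u y K ⊆ lineSection u y K' := fun _ _ hs => h hs
  ⟨hx.1.mono (h' _), hx.2.trans (measure_mono (h' _))⟩

theorem steinerSymmetral_closedBall_subset (hu : ‖u‖ = 1) (r : ℝ) :
    steinerSymmetral u (closedBall 0 r) ⊆ closedBall 0 r := by
  rintro x ⟨⟨s, hs⟩, hx⟩
  set y := hyperplaneFoot u x
  have hy : ⟪u, y⟫_ℝ = 0 := inner_hyperplaneFoot hu x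
  have hsec : ∀ t ∈ lineSection u y (closedBall 0 r), ‖y‖ ^ 2 + t ^ 2 ≤ r ^ 2 := by
    intro t ht
    have ht' : ‖y + t • u‖ ≤ r := by simpa [lineSection] using ht
    rw [← norm_add_smul_sq hu hy]
    exact pow_le_pow_left₀ (norm_nonneg _) ht' 2
  have hr : 0 ≤ r := (norm_nonneg (y + s • u)).trans (by simpa [lineSection] using hs)
  set ρ := √(r ^ 2 - ‖y‖ ^ 2)
  have hρ : ρ ^ 2 = r ^ 2 - ‖y‖ ^ 2 := Real.sq_sqrt (by nlinarith [hsec s hs, sq_nonneg s])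
  have hsub : lineSection u y (closedBall 0 r) ⊆ Icc (-ρ) ρ := fun t ht => by
    rw [mem_Icc, ← abs_le]
    exact Real.abs_le_sqrt (by linarith [hsec t ht])
  have h1 := hx.trans (measure_mono hsub)
  rw [Real.volume_Icc, ENNReal.ofReal_le_ofReal_iff
    (by linarith [Real.sqrt_nonneg (r ^ 2 - ‖y‖ ^ 2)])] at h1
  have h2 : |⟪u, x⟫_ℝ| ≤ ρ := by linarith
  have h3 : ⟪u, x⟫_ℝ ^ 2 ≤ ρ ^ 2 := by
    rw [← sq_abs]; exact pow_le_pow_left₀ (abs_nonneg _) h2 2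
  rw [mem_closedBall_zero_iff, ← sq_le_sq₀ (norm_nonneg _) hr, norm_sq_eq_hyperplaneFoot hu]
  linarith

theorem steinerSymmetral_subset_closedBall (hu : ‖u‖ = 1) {r : ℝ} (h : K ⊆ closedBall 0 r) :
    steinerSymmetral u K ⊆ closedBall 0 r :=
  (steinerSymmetral_mono h).trans (steinerSymmetral_closedBall_subset hu r)

theorem Set.Nonempty.steinerSymmetral (hu : ‖u‖ = 1) (h : K.Nonempty) :
    (steinerSymmetral u K).Nonempty := by
  obtain ⟨x, hx⟩ := h
  have hy := inner_hyperplaneFoot hu x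
  refine ⟨hyperplaneFoot u x + (0 : ℝ) • u, (add_smul_mem_steinerSymmetral hu hy 0).2
    ⟨⟨⟪u, x⟫_ℝ, ?_⟩, by simp⟩⟩
  simpa [lineSection, hyperplaneFoot_add_inner_smul] using hx

/-- The symmetral of a compact set is closed because the length of the sections is upper
semicontinuous. -/
theorem IsCompact.steinerSymmetral (hu : ‖u‖ = 1) (hK : IsCompact K) :
    IsCompact (steinerSymmetral u K) := by
  obtain ⟨r, hr⟩ := hK.isBounded.subset_closedBall 0
  refine (isCompact_closedBall 0 r).of_isClosed_subset ?_ (steinerSymmetral_subset_closedBall hu hr)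
  refine isClosed_iff_frequently.2 fun x hx => ⟨?_, ?_⟩
  · by_contra hne
    rw [not_nonempty_iff_eq_empty] at hne
    have h1 := continuous_hyperplaneFoot.continuousAt.eventually
      (eventually_lineSection_subset hu hK (hyperplaneFoot u x) isOpen_empty hne.le)
    obtain ⟨z, hz, hz'⟩ := (hx.and_eventually h1).exists
    exact hz.1.ne_empty (subset_empty_iff.1 hz')
  · by_contra! hlt
    obtain ⟨U, hU, hUo, hUlt⟩ := Set.exists_isOpen_lt_of_lt _ _ hlt
    have h1 := continuous_hyperplaneFoot.continuousAt.eventually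
      (eventually_lineSection_subset hu hK (hyperplaneFoot u x) hUo hU)
    have hc : Continuous fun z => ENNReal.ofReal (2 * |⟪u, z⟫_ℝ|) :=
      ENNReal.continuous_ofReal.comp (by fun_prop)
    have h2 : ∀ᶠ z in 𝓝 x, volume U < ENNReal.ofReal (2 * |⟪u, z⟫_ℝ|) :=
      continuousAt_const.eventually_lt hc.continuousAt hUlt
    obtain ⟨z, hz, hz', hz''⟩ := (hx.and_eventually (h1.and h2)).exists
    exact absurd (hz.2.trans (measure_mono hz')) (not_le.2 hz'')

theorem lineSection_steinerSymmetral (hu : ‖u‖ = 1) (hK : IsCompact K)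
    {y : EuclideanSpace ℝ (Fin n)} (hy : ⟪u, y⟫_ℝ = 0) (hne : (lineSection u y K).Nonempty) :
    lineSection u y (steinerSymmetral u K) =
      Icc (-((volume (lineSection u y K)).toReal / 2)) ((volume (lineSection u y K)).toReal / 2) := by
  ext s
  have hfin := (isCompact_lineSection hu y hK).measure_lt_top (μ := volume)
  rw [lineSection, mem_ofPred_eq, add_smul_mem_steinerSymmetral hu hy, mem_Icc, ← abs_le,
    ENNReal.ofReal_le_iff_le_toReal hfin.ne]
  exact ⟨fun h => by linarith [h.2], fun h => ⟨hne, by linarith⟩⟩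

theorem volume_lineSection_steinerSymmetral (hu : ‖u‖ = 1) (hK : IsCompact K)
    {y : EuclideanSpace ℝ (Fin n)} (hy : ⟪u, y⟫_ℝ = 0) :
    volume (lineSection u y (steinerSymmetral u K)) = volume (lineSection u y K) := by
  rcases (lineSection u y K).eq_empty_or_nonempty with h | h
  · have : lineSection u y (steinerSymmetral u K) = ∅ := eq_empty_of_forall_notMem fun s hs =>
      ((add_smul_mem_steinerSymmetral hu hy s).1 hs).1.ne_empty h
    rw [h, this]
  · have hfin := (isCompact_lineSection hu y hK).measure_lt_top (μ := volume)
    rw [lineSection_steinerSymmetral hu hK hy h, Real.volume_Icc, sub_neg_eq_add, add_halves,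
      ENNReal.ofReal_toReal hfin.ne]

theorem lineSection_hyperplaneFoot (x : EuclideanSpace ℝ (Fin n)) :
    lineSection u (hyperplaneFoot u x) K = (fun s => s + -⟪u, x⟫_ℝ) ⁻¹' lineSection u x K := by
  ext s
  have : x - ⟪u, x⟫_ℝ • u + s • u = x + (s + -⟪u, x⟫_ℝ) • u := by rw [add_smul, neg_smul]; abel
  simp only [lineSection, hyperplaneFoot, mem_ofPred_eq, mem_preimage, this]

/-- Cavalieri's principle along `u`: the volume of `K` is the integral, over the slab
`0 ≤ ⟪u, x⟫ ≤ 1` of unit width, of the length of the section of `K` by the line through `x`. It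
follows from Tonelli's theorem and translation invariance, with no choice of coordinates. -/
theorem volume_eq_lintegral_lineSection (hu : ‖u‖ = 1) (hK : MeasurableSet K) :
    volume K = ∫⁻ x, (Icc (0 : ℝ) 1).indicator 1 ⟪u, x⟫_ℝ * volume (lineSection u x K) := by
  set φ : ℝ → ENNReal := (Icc (0 : ℝ) 1).indicator 1
  have hφ : Measurable φ := measurable_one.indicator measurableSet_Icc
  set f : EuclideanSpace ℝ (Fin n) → ENNReal := K.indicator 1
  have hf : Measurable f := measurable_one.indicator hK
  calc volume K = ∫⁻ x, f x := (lintegral_indicator_one hK).symm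
    _ = ∫⁻ x, ∫⁻ s : ℝ, f x * φ (⟪u, x⟫_ℝ - s) := by
      refine lintegral_congr fun x => ?_
      rw [lintegral_const_mul _ (by fun_prop), lintegral_sub_left_eq_self φ,
        lintegral_indicator_one measurableSet_Icc]
      simp
    _ = ∫⁻ s : ℝ, ∫⁻ x, f x * φ (⟪u, x⟫_ℝ - s) := lintegral_lintegral_swap (by fun_prop)
    _ = ∫⁻ s : ℝ, ∫⁻ x, f (x + s • u) * φ ⟪u, x⟫_ℝ := by
      refine lintegral_congr fun s => ?_
      rw [← lintegral_add_right_eq_self _ (s • u)]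
      simp [inner_add_right, inner_smul_right, hu]
    _ = ∫⁻ x, ∫⁻ s : ℝ, f (x + s • u) * φ ⟪u, x⟫_ℝ := lintegral_lintegral_swap (by fun_prop)
    _ = ∫⁻ x, φ ⟪u, x⟫_ℝ * volume (lineSection u x K) := by
      refine lintegral_congr fun x => ?_
      have hm : Measurable fun s : ℝ => x + s • u := by fun_prop
      have hs : volume (lineSection u x K) = ∫⁻ s : ℝ, f (x + s • u) :=
        (lintegral_indicator_one (hm hK)).symm
      rw [lintegral_mul_const _ (by fun_prop), mul_comm, hs]

theorem volume_steinerSymmetral (hu : ‖u‖ = 1) (hK : IsCompact K) :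
    volume (steinerSymmetral u K) = volume K := by
  rw [volume_eq_lintegral_lineSection hu hK.measurableSet,
    volume_eq_lintegral_lineSection hu (hK.steinerSymmetral hu).measurableSet]
  refine lintegral_congr fun x => ?_
  have key : ∀ K' : Set (EuclideanSpace ℝ (Fin n)),
      volume (lineSection u x K') = volume (lineSection u (hyperplaneFoot u x) K') := fun K' => by
    rw [lineSection_hyperplaneFoot, measure_preimage_add_right]
  rw [key, key K, volume_lineSection_steinerSymmetral hu hK (inner_hyperplaneFoot hu x)]

/-- A one-dimensional Brunn–Minkowski inequality: adding an interval of radius `r` to a compact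
set lengthens it by at least `2 r`. -/
theorem volume_add_le_of_forall_abs_sub_le {T T' : Set ℝ} (hT : IsCompact T) (hne : T.Nonempty)
    {r : ℝ} (hr : 0 ≤ r) (h : ∀ t ∈ T, ∀ s, |s - t| ≤ r → s ∈ T') :
    volume T + ENNReal.ofReal (2 * r) ≤ volume T' := by
  obtain ⟨b, hb⟩ := hT.exists_isGreatest hne
  have hdisj : Disjoint ((fun s => s + r) ⁻¹' T) (Ioc (b - r) (b + r)) :=
    disjoint_left.2 fun s hs hs' => by
      have := hb.2 hs
      linarith [hs'.1]
  have hsub : (fun s => s + r) ⁻¹' T ∪ Ioc (b - r) (b + r) ⊆ T' := by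
    rintro s (hs | hs)
    · exact h _ hs s (by simp [abs_of_nonneg hr])
    · exact h b hb.1 s (abs_le.2 ⟨by linarith [hs.1], by linarith [hs.2]⟩)
  calc volume T + ENNReal.ofReal (2 * r)
      = volume ((fun s => s + r) ⁻¹' T) + volume (Ioc (b - r) (b + r)) := by
        rw [measure_preimage_add_right, Real.volume_Ioc]; ring_nf
    _ = volume ((fun s => s + r) ⁻¹' T ∪ Ioc (b - r) (b + r)) :=
        (measure_union hdisj measurableSet_Ioc).symm
    _ ≤ volume T' := measure_mono hsub

theorem cthickening_steinerSymmetral_subset (hu : ‖u‖ = 1) (hK : IsCompact K) {δ : ℝ}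
    (hδ : 0 ≤ δ) :
    cthickening δ (steinerSymmetral u K) ⊆ steinerSymmetral u (cthickening δ K) := by
  rw [(hK.steinerSymmetral hu).cthickening_eq_biUnion_closedBall hδ]
  simp only [iUnion_subset_iff]
  intro x hx z hz
  obtain ⟨h, rfl⟩ : ∃ h, z = x + h := ⟨z - x, by simp⟩
  have hh : ‖h‖ ≤ δ := by simpa using hz
  set y := hyperplaneFoot u x
  set y' := hyperplaneFoot u h
  have hy' : ⟪u, y'⟫_ℝ = 0 := inner_hyperplaneFoot hu h
  have hfoot : hyperplaneFoot u (x + h) = y + y' := hyperplaneFoot_add x h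
  have hn := norm_sq_eq_hyperplaneFoot hu h
  have hδ2 : ‖h‖ ^ 2 ≤ δ ^ 2 := pow_le_pow_left₀ (norm_nonneg _) hh 2
  set r := √(δ ^ 2 - ‖y'‖ ^ 2)
  have hr2 : r ^ 2 = δ ^ 2 - ‖y'‖ ^ 2 := Real.sq_sqrt (by nlinarith [sq_nonneg ⟪u, h⟫_ℝ])
  have hsec : ∀ t ∈ lineSection u y K, ∀ s, |s - t| ≤ r →
      s ∈ lineSection u (y + y') (cthickening δ K) := by
    intro t ht s hst
    refine mem_cthickening_of_dist_le _ (y + t • u) _ _ ht ?_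
    have he : y + y' + s • u - (y + t • u) = y' + (s - t) • u := by rw [sub_smul]; abel
    rw [dist_eq_norm, he, ← sq_le_sq₀ (norm_nonneg _) hδ, norm_add_smul_sq hu hy', ← sq_abs (s - t)]
    have := pow_le_pow_left₀ (abs_nonneg _) hst 2
    linarith
  have hle := volume_add_le_of_forall_abs_sub_le (isCompact_lineSection hu y hK) hx.1
    (Real.sqrt_nonneg _) hsec
  refine ⟨?_, ?_⟩
  · rw [hfoot]
    obtain ⟨t, ht⟩ := hx.1
    exact ⟨t, hsec t ht t (by simp [r])⟩
  · rw [hfoot]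
    refine le_trans ?_ hle
    refine le_trans ?_ (add_le_add_left hx.2 _)
    rw [← ENNReal.ofReal_add (by positivity) (by positivity)]
    refine ENNReal.ofReal_le_ofReal ?_
    have h1 : |⟪u, h⟫_ℝ| ≤ r := Real.abs_le_sqrt (by linarith)
    rw [inner_add_right]
    linarith [abs_add_le ⟪u, x⟫_ℝ ⟪u, h⟫_ℝ]

end Steiner

/-! ### The rotation taking one direction to another -/

section Rotation

variable {n : ℕ}

/-- The rotation in the plane of the unit vectors `a` and `b` that takes `a` to `b`, as the product
of the reflections in the hyperplanes orthogonal to `a` and to `a + b`. It is meant for `b ≠ -a`. -/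
noncomputable def planeRotation (a b : EuclideanSpace ℝ (Fin n)) :
    EuclideanSpace ℝ (Fin n) ≃ₗᵢ[ℝ] EuclideanSpace ℝ (Fin n) :=
  (ℝ ∙ a)ᗮ.reflection.trans (ℝ ∙ (a + b))ᗮ.reflection

theorem planeRotation_apply {a b : EuclideanSpace ℝ (Fin n)} (ha : ‖a‖ = 1) (hb : ‖b‖ = 1)
    (hab : 0 < ⟪b, a⟫_ℝ) (x : EuclideanSpace ℝ (Fin n)) :
    planeRotation a b x =
      x + (2 * ⟪a, x⟫_ℝ) • b - ((⟪a, x⟫_ℝ + ⟪b, x⟫_ℝ) / (1 + ⟪b, a⟫_ℝ)) • (a + b) := by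
  have h1 : ‖a + b‖ ^ 2 = 2 * (1 + ⟪b, a⟫_ℝ) := by
    rw [norm_add_sq_real, ha, hb, real_inner_comm]; ring
  have h2 : 1 + ⟪b, a⟫_ℝ ≠ 0 := by positivity
  simp only [planeRotation, LinearIsometryEquiv.trans_apply, Submodule.reflection_orthogonal_apply,
    Submodule.reflection_singleton_apply, h1, ha, RCLike.ofReal_real_eq_id, id_eq, inner_neg_right,
    inner_sub_right, inner_add_left, inner_add_right, inner_smul_right, two_smul,
    real_inner_self_eq_norm_sq, one_pow, div_one]
  have h3 : (⟪a, x⟫_ℝ + ⟪b, x⟫_ℝ) / (1 + ⟪b, a⟫_ℝ) - 2 * ⟪a, x⟫_ℝ =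
    2 * ((⟪a, x⟫_ℝ + ⟪b, x⟫_ℝ - 2 * ⟪a, x⟫_ℝ * (1 + ⟪b, a⟫_ℝ)) / (2 * (1 + ⟪b, a⟫_ℝ))) := by
    field_simp
  generalize (⟪a, x⟫_ℝ + ⟪b, x⟫_ℝ) / (1 + ⟪b, a⟫_ℝ) = q at *
  obtain rfl : q = _ := eq_add_of_sub_eq h3
  module

theorem planeRotation_apply_self {a b : EuclideanSpace ℝ (Fin n)} (ha : ‖a‖ = 1) (hb : ‖b‖ = 1)
    (hab : 0 < ⟪b, a⟫_ℝ) : planeRotation a b a = b := by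
  rw [planeRotation_apply ha hb hab, real_inner_self_eq_norm_sq, ha, one_pow,
    div_self (by positivity)]
  module

theorem isRotation_planeRotation {a b : EuclideanSpace ℝ (Fin n)} (ha : ‖a‖ = 1)
    (hab : 0 < ⟪b, a⟫_ℝ) : IsRotation (planeRotation a b) := by
  have h0 : a ≠ 0 := by rintro rfl; simp at ha
  have h1 : a + b ≠ 0 := by
    intro h
    rw [eq_neg_of_add_eq_zero_right h, inner_neg_left, real_inner_self_eq_norm_sq, ha] at hab
    norm_num at hab
  have hdet : ∀ w : EuclideanSpace ℝ (Fin n), w ≠ 0 →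
      LinearMap.det (ℝ ∙ w)ᗮ.reflection.toLinearMap = -1 := fun w hw => by
    rw [Submodule.det_reflection, Submodule.orthogonal_orthogonal, finrank_span_singleton hw,
      pow_one]
  have : ((planeRotation a b).toLinearEquiv : EuclideanSpace ℝ (Fin n) →ₗ[ℝ] _) =
      (ℝ ∙ (a + b))ᗮ.reflection.toLinearMap ∘ₗ (ℝ ∙ a)ᗮ.reflection.toLinearMap := rfl
  rw [IsRotation, this, LinearMap.det_comp, hdet _ h0, hdet _ h1]
  norm_num

theorem IsRotation.trans {R R' : EuclideanSpace ℝ (Fin n) ≃ₗᵢ[ℝ] EuclideanSpace ℝ (Fin n)}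
    (h : IsRotation R) (h' : IsRotation R') : IsRotation (R.trans R') := by
  have : ((R.trans R').toLinearEquiv : EuclideanSpace ℝ (Fin n) →ₗ[ℝ] _) =
      (R'.toLinearEquiv : EuclideanSpace ℝ (Fin n) →ₗ[ℝ] EuclideanSpace ℝ (Fin n)) ∘ₗ
        (R.toLinearEquiv : EuclideanSpace ℝ (Fin n) →ₗ[ℝ] EuclideanSpace ℝ (Fin n)) := rfl
  rw [IsRotation, this, LinearMap.det_comp, h, h', one_mul]

theorem isRotation_refl :
    IsRotation (LinearIsometryEquiv.refl ℝ (EuclideanSpace ℝ (Fin n))) :=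
  LinearMap.det_id

/-- On the hyperplane orthogonal to `v`, the rotation taking `v` to `u` agrees to second order in
the angle with the projection parallel to `v` onto the hyperplane orthogonal to `u`. -/
theorem norm_planeRotation_sub_le {u v : EuclideanSpace ℝ (Fin n)} (hu : ‖u‖ = 1) (hv : ‖v‖ = 1)
    (hc : 1 / 2 ≤ ⟪u, v⟫_ℝ) {y : EuclideanSpace ℝ (Fin n)} (hy : ⟪v, y⟫_ℝ = 0) :
    ‖planeRotation v u y - (y - (⟪u, y⟫_ℝ / ⟪u, v⟫_ℝ) • v)‖ ≤ 2 * (1 - ⟪u, v⟫_ℝ ^ 2) * ‖y‖ := by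
  set c := ⟪u, v⟫_ℝ
  have hw2 : ‖v - c • u‖ ^ 2 = 1 - c ^ 2 := by
    rw [norm_sub_sq_real, norm_smul, inner_smul_right, real_inner_comm, hu, hv, Real.norm_eq_abs,
      mul_one, sq_abs]
    simp only [c]; ring
  have hw2' : ‖u - c • v‖ ^ 2 = 1 - c ^ 2 := by
    rw [norm_sub_sq_real, norm_smul, inner_smul_right, hu, hv, Real.norm_eq_abs,
      mul_one, sq_abs]
    simp only [c]; ring
  have hw : ‖u - c • v‖ = ‖v - c • u‖ := by
    rw [← abs_of_nonneg (norm_nonneg (u - _)), ← abs_of_nonneg (norm_nonneg (v - _)),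
      ← sq_eq_sq_iff_abs_eq_abs, hw2, hw2']
  have huy : |⟪u, y⟫_ℝ| ≤ ‖v - c • u‖ * ‖y‖ := by
    have : ⟪u, y⟫_ℝ = ⟪u - c • v, y⟫_ℝ := by simp [inner_sub_left, inner_smul_left, hy]
    rw [this, ← hw]; exact abs_real_inner_le_norm _ _
  have he : planeRotation v u y - (y - (⟪u, y⟫_ℝ / c) • v) =
      (⟪u, y⟫_ℝ / (c * (1 + c))) • (v - c • u) := by
    rw [planeRotation_apply hv hu (by linarith), hy]
    have h1 : ⟪u, y⟫_ℝ / c = ⟪u, y⟫_ℝ / (c * (1 + c)) * (1 + c) := by field_simp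
    have h2 : ⟪u, y⟫_ℝ / (1 + c) = ⟪u, y⟫_ℝ / (c * (1 + c)) * c := by field_simp
    rw [zero_add, h1, h2]
    module
  rw [he, norm_smul, Real.norm_eq_abs, abs_div, abs_of_pos (by positivity : 0 < c * (1 + c)),
    ← hw2, div_mul_eq_mul_div, div_le_iff₀ (by positivity)]
  have h3 : 1 / 2 ≤ c * (1 + c) := by nlinarith
  have h4 : 0 ≤ ‖v - c • u‖ ^ 2 * ‖y‖ := by positivity
  nlinarith [mul_le_mul_of_nonneg_right huy (norm_nonneg (v - c • u))]

end Rotation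

/-! ### Paraboloidal barriers -/

section Barrier

variable {n : ℕ}

/-- The region between the paraboloid of height `β + C ‖y - p‖ ^ 2` above the foot `y` on the
hyperplane orthogonal to `u` and its mirror image in that hyperplane. Over the feet where this
height is negative, the region is empty. -/
def paraboloidRegion (u p : EuclideanSpace ℝ (Fin n)) (C β : ℝ) : Set (EuclideanSpace ℝ (Fin n)) :=
  {x | |⟪u, x⟫_ℝ| ≤ β + C * ‖hyperplaneFoot u x - p‖ ^ 2}

theorem paraboloidRegion_mono {u p : EuclideanSpace ℝ (Fin n)} {C β β' : ℝ} (h : β ≤ β') :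
    paraboloidRegion u p C β ⊆ paraboloidRegion u p C β' := fun x hx => by
  simp only [paraboloidRegion, mem_ofPred_eq] at hx ⊢
  linarith

/-- A set of reals in the slanted wedge `c |t| ≤ A + h t` has length at most `2 c A / (c² - h²)`;
the tilt `h` enters only to second order. -/
theorem volume_le_of_forall_mul_abs_le {T : Set ℝ} (hne : T.Nonempty) {c h A : ℝ} (hh : |h| < c)
    (hT : ∀ t ∈ T, c * |t| ≤ A + h * t) :
    0 ≤ A ∧ volume T ≤ ENNReal.ofReal (2 * (A * c / (c ^ 2 - h ^ 2))) := by
  obtain ⟨h1, h2⟩ := abs_lt.1 hh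
  constructor
  · obtain ⟨t, ht⟩ := hne
    have := hT t ht
    nlinarith [abs_nonneg t, le_abs_self (h * t), abs_mul h t, mul_le_mul_of_nonneg_right hh.le
      (abs_nonneg t)]
  · have hsub : T ⊆ Icc (-(A / (c + h))) (A / (c - h)) := fun t ht => by
      have := hT t ht
      constructor
      · rw [neg_le, le_div_iff₀ (by linarith)]
        nlinarith [neg_abs_le t]
      · rw [le_div_iff₀ (by linarith)]
        nlinarith [le_abs_self t]
    refine (measure_mono hsub).trans ?_
    rw [Real.volume_Icc]
    refine le_of_eq (congrArg _ ?_)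
    have h3 : c + h ≠ 0 := by linarith
    have h4 : c - h ≠ 0 := by linarith
    have h5 : c ^ 2 - h ^ 2 ≠ 0 := by
      rw [sq_sub_sq]; exact mul_ne_zero h3 h4
    field_simp
    ring

/-- If a set lies in a paraboloidal region of axis `u`, then symmetrizing it along a nearby
direction `v` moves it into the region rotated to axis `v` and raised by no more than a constant
times the square of the sine of the angle. The first order effect of the tilt moves the two ends of
a section by equal amounts in the same direction, and recentring the section cancels it. -/
theorem exists_steinerSymmetral_subset_paraboloidRegion {r C B : ℝ} (hr : 0 ≤ r) (hC : 0 ≤ C)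
    (hB : 0 ≤ B) :
    ∃ k ≥ 0, ∃ ε > 0, ∀ u v p : EuclideanSpace ℝ (Fin n), ‖u‖ = 1 → ‖v‖ = 1 → ‖p‖ ≤ r →
      0 < ⟪u, v⟫_ℝ → 1 - ⟪u, v⟫_ℝ ^ 2 ≤ ε → ∀ β ≤ B, ∀ A ⊆ closedBall 0 r,
      A ⊆ paraboloidRegion u p C β →
      steinerSymmetral v A ⊆ paraboloidRegion v ((planeRotation v u).symm p) C
        (β + k * (1 - ⟪u, v⟫_ℝ ^ 2)) := by
  set D := 64 * C ^ 2 * r ^ 2 with hD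
  have hD0 : 0 ≤ D := by positivity
  refine ⟨12 * C * r ^ 2 + 9 * C * r ^ 2 + 8 * (1 + D) * (B + 25 * C * r ^ 2), by positivity,
    min (1 / 2) (1 / (8 * (1 + D))), by positivity, ?_⟩
  intro u v p hu hv hp hc0 hε β hβ A hA hAP z hz
  set c := ⟪u, v⟫_ℝ
  have hc1 : c ≤ 1 := by
    have := real_inner_le_norm u v
    rwa [hu, hv, one_mul] at this
  set σ := 1 - c ^ 2 with hσ
  have hσ0 : 0 ≤ σ := by nlinarith
  have hσ1 : σ ≤ 1 / 2 := hε.trans (min_le_left _ _)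
  have hσD : (1 + D) * σ ≤ 1 / 8 := by
    have := hε.trans (min_le_right _ _)
    rw [le_div_iff₀ (by positivity)] at this
    linarith
  have hc : 1 / 2 ≤ c := by nlinarith
  set y := hyperplaneFoot v z
  have hy : ⟪v, y⟫_ℝ = 0 := inner_hyperplaneFoot hv z
  obtain ⟨hne, hz2⟩ := hz
  have hsec : ∀ t ∈ lineSection v y A, ‖y‖ ≤ r ∧ |t| ≤ r := by
    intro t ht
    have h1 : ‖y + t • v‖ ≤ r := by simpa using hA ht
    have h2 := norm_add_smul_sq hv hy t
    have h3 := pow_le_pow_left₀ (norm_nonneg _) h1 2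
    exact ⟨(sq_le_sq₀ (norm_nonneg _) hr).1 (by nlinarith [sq_nonneg t]),
      abs_le_of_sq_le_sq (by nlinarith [sq_nonneg ‖y‖]) hr⟩
  have hyr : ‖y‖ ≤ r := hne.elim fun t ht => (hsec t ht).1
  have huy : |⟪u, y⟫_ℝ| ≤ r := (abs_inner_le_norm_of_unit hu y).trans hyr
  -- the point of the line `y + ℝ v` on the hyperplane orthogonal to `u`, taken as new origin
  set b := ⟪u, y⟫_ℝ / c with hb
  set y₁ := y - b • v with hy₁
  have hbr : |b| ≤ 2 * r := by
    rw [hb, abs_div, abs_of_pos hc0, div_le_iff₀ hc0]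
    nlinarith
  have hq : ‖planeRotation v u y - p‖ ≤ 2 * r :=
    (norm_sub_le _ _).trans (by rw [LinearIsometryEquiv.norm_map]; linarith)
  have hy₁p : ‖y₁ - p‖ ≤ 4 * r := by
    refine (norm_sub_le _ _).trans ?_
    have : ‖y₁‖ ≤ ‖y‖ + ‖b • v‖ := norm_sub_le _ _
    rw [norm_smul, hv, mul_one, Real.norm_eq_abs] at this
    linarith
  have hw2 : ‖v - c • u‖ ^ 2 = σ := by
    rw [norm_sub_sq_real, norm_smul, inner_smul_right, real_inner_comm, hu, hv, Real.norm_eq_abs,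
      mul_one, sq_abs]
    simp only [c, hσ]; ring
  set g := ⟪y₁ - p, v - c • u⟫_ℝ with hg
  have hg2 : g ^ 2 ≤ 16 * r ^ 2 * σ := by
    rw [← sq_abs, ← hw2]
    calc |g| ^ 2 ≤ (‖y₁ - p‖ * ‖v - c • u‖) ^ 2 :=
          pow_le_pow_left₀ (abs_nonneg _) (abs_real_inner_le_norm _ _) 2
      _ ≤ (4 * r * ‖v - c • u‖) ^ 2 := by gcongr
      _ = _ := by ring
  set h := 2 * C * g with hh
  have hh2 : h ^ 2 ≤ D * σ := by
    rw [hh, hD]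
    linarith [mul_le_mul_of_nonneg_left hg2 (sq_nonneg C)]
  set A₀ := β + C * ‖y₁ - p‖ ^ 2 + 9 * C * r ^ 2 * σ with hA₀
  have hgap : 1 / 8 ≤ c ^ 2 - h ^ 2 := by linarith
  have hhc : |h| < c := abs_lt_of_sq_lt_sq (by linarith) hc0.le
  have hT : ∀ t ∈ (fun s => s + -b) ⁻¹' lineSection v y A, c * |t| ≤ A₀ + h * t := by
    intro t ht
    have ht' : t + -b ∈ lineSection v y A := ht
    have hmem : y + (t + -b) • v = y₁ + t • v := by rw [hy₁]; module
    have h1 := hAP ht'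
    have hin : ⟪u, y₁ + t • v⟫_ℝ = t * c := by
      have h0 : ⟪u, y₁⟫_ℝ = 0 := by
        rw [hy₁, inner_sub_right, inner_smul_right, hb, div_mul_cancel₀ _ hc0.ne', sub_self]
      rw [inner_add_right, inner_smul_right, h0, zero_add]
    have hft : hyperplaneFoot u (y₁ + t • v) - p = (y₁ - p) + t • (v - c • u) := by
      rw [hyperplaneFoot, hin]; module
    simp only [paraboloidRegion, mem_ofPred_eq, hmem, hin, hft] at h1
    rw [norm_add_sq_real, inner_smul_right, ← hg, norm_smul, mul_pow, hw2, Real.norm_eq_abs,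
      sq_abs, abs_mul, abs_of_pos hc0] at h1
    have htr : |t| ≤ 3 * r := by
      have h2 := abs_add_le (t + -b) b
      rw [neg_add_cancel_right] at h2
      linarith [(hsec _ ht').2]
    have ht2 : t ^ 2 ≤ 9 * r ^ 2 := by
      have := pow_le_pow_left₀ (abs_nonneg t) htr 2
      rw [sq_abs] at this
      linarith
    have h3 : C * (t ^ 2 * σ) ≤ C * (9 * r ^ 2 * σ) := by gcongr
    rw [hA₀, hh]
    linarith
  have hne' : ((fun s => s + -b) ⁻¹' lineSection v y A).Nonempty := by
    obtain ⟨t, ht⟩ := hne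
    exact ⟨t + b, by simpa using ht⟩
  obtain ⟨hA0, hvol⟩ := volume_le_of_forall_mul_abs_le hne' hhc hT
  rw [measure_preimage_add_right] at hvol
  have hz3 := hz2.trans hvol
  rw [ENNReal.ofReal_le_ofReal_iff (by positivity)] at hz3
  have hz4 : |⟪v, z⟫_ℝ| ≤ A₀ * (1 + 8 * (1 + D) * σ) := by
    refine (le_of_mul_le_mul_left hz3 two_pos).trans ?_
    rw [mul_div_assoc]
    refine mul_le_mul_of_nonneg_left ?_ hA0
    rw [div_le_iff₀ (by linarith)]
    have h1 : c - (c ^ 2 - h ^ 2) ≤ (1 + D) * σ := by linarith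
    have h2 : 0 ≤ 8 * (1 + D) * σ := by positivity
    linarith [mul_le_mul_of_nonneg_left hgap h2]
  have hsq : ‖y₁ - p‖ ^ 2 ≤ ‖planeRotation v u y - p‖ ^ 2 + 12 * r ^ 2 * σ := by
    have h1 := norm_planeRotation_sub_le hu hv hc hy
    have h2 : ‖y₁ - p‖ ≤ ‖planeRotation v u y - p‖ + ‖planeRotation v u y - y₁‖ := by
      rw [add_comm]
      simpa [norm_sub_rev] using norm_sub_le_norm_sub_add_norm_sub y₁ (planeRotation v u y) p
    have h3 : ‖planeRotation v u y - y₁‖ ≤ 2 * σ * r :=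
      h1.trans (mul_le_mul_of_nonneg_left hyr (by positivity))
    have h4 : ‖y₁ - p‖ - ‖planeRotation v u y - p‖ ≤ 2 * σ * r := by linarith
    have h5 : 0 ≤ ‖y₁ - p‖ + ‖planeRotation v u y - p‖ := by positivity
    have h6 : ‖y₁ - p‖ + ‖planeRotation v u y - p‖ ≤ 6 * r := by linarith
    have h7 : 0 ≤ 2 * σ * r := by positivity
    linarith [mul_le_mul_of_nonneg_right h4 h5, mul_le_mul_of_nonneg_left h6 h7]
  have hA₀le : A₀ ≤ B + 25 * C * r ^ 2 := by
    have h1 : ‖y₁ - p‖ ^ 2 ≤ (4 * r) ^ 2 := pow_le_pow_left₀ (norm_nonneg _) hy₁p 2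
    have h2 : 9 * C * r ^ 2 * σ ≤ 9 * C * r ^ 2 * 1 := by gcongr; linarith
    rw [hA₀]
    linarith [mul_le_mul_of_nonneg_left h1 hC]
  have hrot : ‖planeRotation v u y - p‖ = ‖y - (planeRotation v u).symm p‖ := by
    rw [← LinearIsometryEquiv.norm_map (planeRotation v u) (y - _), map_sub,
      LinearIsometryEquiv.apply_symm_apply]
  change |⟪v, z⟫_ℝ| ≤ _ + C * ‖y - _‖ ^ 2
  rw [← hrot]
  have h8 : A₀ * (8 * (1 + D) * σ) ≤ (B + 25 * C * r ^ 2) * (8 * (1 + D) * σ) := by gcongr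
  have h9 := mul_le_mul_of_nonneg_left hsq hC
  rw [hA₀] at hz4 h8
  linarith

end Barrier

/-! ### Convergence criteria for sequences of sets -/

section Convergence

/-- Sets in a fixed compact set converge in the Hausdorff distance if a set that stays away from a
point forces all later ones to stay away from it: a point that is approached infinitely often is
then approached all the time. -/
theorem exists_tendsto_hausdorffEDist_of_forall_le_dist {X : Type*} [MetricSpace X]
    {A : ℕ → Set X} {S : Set X} (hS : IsCompact S) (hA : ∀ m, A m ⊆ S) (hne : ∀ m, (A m).Nonempty)
    (h : ∀ x, ∀ η > 0, ∃ ε > 0, ∃ M, ∀ m ≥ M, (∀ z ∈ A m, η ≤ dist z x) →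
      ∀ m' ≥ m, ∀ z ∈ A m', ε ≤ dist z x) :
    ∃ L, IsCompact L ∧ L.Nonempty ∧ Tendsto (fun m => hausdorffEDist (A m) L) atTop (𝓝 0) := by
  set L := {x | ∀ ε > 0, ∀ᶠ m in atTop, ∃ z ∈ A m, dist z x < ε} with hL
  have hfreq : ∀ x, (∀ ε > 0, ∃ᶠ m in atTop, ∃ z ∈ A m, dist z x < ε) → x ∈ L := by
    intro x hx η hη
    by_contra hcon
    obtain ⟨ε, hε, M, hM⟩ := h x η hη
    obtain ⟨m, hm, hm'⟩ := (Filter.not_eventually.1 hcon).forall_exists_of_atTop M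
    push Not at hm'
    obtain ⟨m', hm1, z, hz, hz'⟩ := (hx ε hε).forall_exists_of_atTop m
    exact absurd (hM m hm hm' m' hm1 z hz) (not_le.2 hz')
  have hclosed : IsClosed L := by
    refine isClosed_of_closure_subset fun x hx ε hε => ?_
    obtain ⟨y, hy, hxy⟩ := Metric.mem_closure_iff.1 hx (ε / 2) (half_pos hε)
    filter_upwards [hy (ε / 2) (half_pos hε)] with m ⟨z, hz, hzy⟩
    exact ⟨z, hz, by linarith [dist_triangle_right z x y]⟩
  have hLS : L ⊆ S := fun x hx => by
    rw [← hS.isClosed.closure_eq, Metric.mem_closure_iff]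
    intro ε hε
    obtain ⟨m, z, hz, hzx⟩ := (hx ε hε).exists
    exact ⟨z, hA m hz, by rwa [dist_comm]⟩
  have hLc : IsCompact L := hS.of_isClosed_subset hclosed hLS
  have hupper : ∀ ε > 0, ∀ᶠ m in atTop, ∀ z ∈ A m, ∃ x ∈ L, dist z x < ε := by
    intro ε hε
    by_contra hcon
    obtain ⟨φ, hφ, hφ'⟩ := extraction_of_frequently_atTop (Filter.not_eventually.1 hcon)
    push Not at hφ'
    choose z hz hzL using hφ'
    obtain ⟨x, -, ψ, hψ, hlim⟩ := hS.tendsto_subseq fun k => hA _ (hz k)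
    have hxL : x ∈ L := hfreq x fun ε' hε' => by
      refine ((hφ.comp hψ).tendsto_atTop).frequently (p := fun m => ∃ z ∈ A m, dist z x < ε')
        (Eventually.frequently ?_)
      filter_upwards [hlim.eventually (ball_mem_nhds x hε')] with k hk
      exact ⟨_, hz (ψ k), hk⟩
    obtain ⟨k, hk⟩ := (hlim.eventually (ball_mem_nhds x hε)).exists
    exact absurd (hzL (ψ k) x hxL) (not_le.2 hk)
  have hlower : ∀ ε > 0, ∀ᶠ m in atTop, ∀ x ∈ L, ∃ z ∈ A m, dist x z < ε := by
    intro ε hε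
    obtain ⟨t, htL, htf, ht⟩ := hLc.finite_cover_balls (half_pos hε)
    filter_upwards [(eventually_all_finite htf).2 fun y hy => htL hy (ε / 2) (half_pos hε)]
      with m hm x hx
    obtain ⟨y, hy, hxy⟩ := mem_iUnion₂.1 (ht hx)
    obtain ⟨z, hz, hzy⟩ := hm y hy
    exact ⟨z, hz, by linarith [dist_triangle_right x z y, mem_ball.1 hxy]⟩
  refine ⟨L, hLc, ?_, ?_⟩
  · obtain ⟨m, hm⟩ := (hupper 1 one_pos).exists
    obtain ⟨z, hz⟩ := hne m
    obtain ⟨x, hx, -⟩ := hm z hz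
    exact ⟨x, hx⟩
  · rw [ENNReal.tendsto_nhds_zero]
    intro ε hε
    obtain ⟨ε', hε', hle⟩ : ∃ ε' : ℝ, 0 < ε' ∧ ENNReal.ofReal ε' ≤ ε := by
      obtain ⟨q, hq, hq'⟩ := ENNReal.lt_iff_exists_nnreal_btwn.1 hε
      exact ⟨q, by exact_mod_cast hq, by simpa using hq'.le⟩
    filter_upwards [hupper ε' hε', hlower ε' hε'] with m h1 h2
    refine le_trans (hausdorffEDist_le_of_mem_edist (fun x hx => ?_) fun x hx => ?_) hle
    · obtain ⟨y, hy, hxy⟩ := h1 x hx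
      exact ⟨y, hy, by rw [edist_dist]; exact ENNReal.ofReal_le_ofReal hxy.le⟩
    · obtain ⟨y, hy, hxy⟩ := h2 x hx
      exact ⟨y, hy, by rw [edist_dist]; exact ENNReal.ofReal_le_ofReal hxy.le⟩

/-- Hausdorff convergence of sets with the measure of `K`, and with parallel sets of at most the
measure of those of `K`, implies convergence in measure. The bound on the parallel sets keeps the
limit from having a larger measure than `K`. -/
theorem tendsto_measure_symmDiff_of_tendsto_hausdorffEDist {X : Type*} [MetricSpace X]
    [ProperSpace X] [MeasurableSpace X] [BorelSpace X] (μ : Measure X) [IsFiniteMeasureOnCompacts μ]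
    {A : ℕ → Set X} {K L : Set X} (hA : ∀ m, IsCompact (A m)) (hK : IsCompact K)
    (hL : IsCompact L) (hAK : ∀ m, μ (A m) = μ K)
    (hth : ∀ m, ∀ δ > 0, μ (cthickening δ (A m)) ≤ μ (cthickening δ K))
    (h : Tendsto (fun m => hausdorffEDist (A m) L) atTop (𝓝 0)) :
    Tendsto (fun m => μ (A m ∆ L)) atTop (𝓝 0) := by
  have hlim : ∀ {S : Set X}, IsCompact S →
      Tendsto (fun δ => μ (cthickening δ S) - μ S) (𝓝[>] 0) (𝓝 0) := fun {S} hS => by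
    have h1 := (tendsto_measure_cthickening_of_isCompact (μ := μ) hS).mono_left
      (nhdsWithin_le_nhds (s := Ioi 0))
    have h2 := ENNReal.Tendsto.sub h1 (tendsto_const_nhds (x := μ S)) (Or.inl hS.measure_ne_top)
    rwa [tsub_self] at h2
  have hsum := (hlim hL).add (hlim hK)
  rw [add_zero] at hsum
  rw [ENNReal.tendsto_nhds_zero] at hsum ⊢
  intro ε hε
  obtain ⟨δ, hδ, hδ0 : 0 < δ⟩ := ((hsum ε hε).and self_mem_nhdsWithin).exists
  filter_upwards [h.eventually (gt_mem_nhds (ENNReal.ofReal_pos.2 hδ0))] with m hm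
  have h1 : A m ⊆ cthickening δ L := fun x hx =>
    mem_cthickening_iff.2 ((infEDist_le_hausdorffEDist_of_mem hx).trans hm.le)
  have h2 : L ⊆ cthickening δ (A m) := fun x hx =>
    mem_cthickening_iff.2 ((infEDist_le_hausdorffEDist_of_mem hx).trans
      (by rw [hausdorffEDist_comm]; exact hm.le))
  calc μ (A m ∆ L) ≤ μ (A m \ L) + μ (L \ A m) := measure_union_le _ _
    _ ≤ μ (cthickening δ L \ L) + μ (cthickening δ (A m) \ A m) := by gcongr
    _ = (μ (cthickening δ L) - μ L) + (μ (cthickening δ (A m)) - μ (A m)) := by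
      rw [measure_sdiff (self_subset_cthickening L) hL.measurableSet.nullMeasurableSet
          hL.measure_ne_top, measure_sdiff (self_subset_cthickening _)
          (hA m).measurableSet.nullMeasurableSet (hA m).measure_ne_top]
    _ ≤ (μ (cthickening δ L) - μ L) + (μ (cthickening δ K) - μ K) := by
      rw [hAK]; exact add_le_add_right (tsub_le_tsub_right (hth m δ hδ0) _) _
    _ ≤ ε := hδ

end Convergence

/-! ### Iterated symmetrals -/

section Iterated

variable {n : ℕ} {u : ℕ → EuclideanSpace ℝ (Fin n)} {K : Set (EuclideanSpace ℝ (Fin n))}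

/-- The rotations that bring all the directions of a sequence to the first one, composed of the
plane rotations that take each direction to its predecessor. -/
noncomputable def aligningRotation (u : ℕ → EuclideanSpace ℝ (Fin n)) :
    ℕ → (EuclideanSpace ℝ (Fin n) ≃ₗᵢ[ℝ] EuclideanSpace ℝ (Fin n))
  | 0 => LinearIsometryEquiv.refl ℝ _
  | 1 => LinearIsometryEquiv.refl ℝ _
  | m + 2 => (planeRotation (u (m + 2)) (u (m + 1))).trans (aligningRotation u (m + 1))

theorem aligningRotation_succ {m : ℕ} (hm : 1 ≤ m) :
    aligningRotation u (m + 1) =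
      (planeRotation (u (m + 1)) (u m)).trans (aligningRotation u m) := by
  obtain ⟨j, rfl⟩ := Nat.exists_eq_add_of_le' hm
  rfl

theorem isRotation_aligningRotation (hu : ∀ m ≥ 1, ‖u m‖ = 1)
    (hpos : ∀ m ≥ 1, 0 < ⟪u m, u (m + 1)⟫_ℝ) (m : ℕ) : IsRotation (aligningRotation u m) := by
  rcases Nat.eq_zero_or_pos m with rfl | hm
  · exact isRotation_refl
  · induction m, hm using Nat.le_induction with
    | base => exact isRotation_refl
    | succ m hm ih =>
      rw [aligningRotation_succ hm]
      exact (isRotation_planeRotation (hu _ (by omega)) (hpos m hm)).trans ih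

theorem aligningRotation_apply (hu : ∀ m ≥ 1, ‖u m‖ = 1)
    (hpos : ∀ m ≥ 1, 0 < ⟪u m, u (m + 1)⟫_ℝ) {m : ℕ} (hm : 1 ≤ m) :
    aligningRotation u m (u m) = u 1 := by
  induction m, hm using Nat.le_induction with
  | base => rfl
  | succ m hm ih =>
    rw [aligningRotation_succ hm, LinearIsometryEquiv.trans_apply,
      planeRotation_apply_self (hu _ (by omega)) (hu m hm) (hpos m hm), ih]

theorem iteratedSymmetral_subset_closedBall (hu : ∀ m ≥ 1, ‖u m‖ = 1) {r : ℝ}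
    (hK : K ⊆ closedBall 0 r) (m : ℕ) : iteratedSymmetral u K m ⊆ closedBall 0 r := by
  induction m with
  | zero => exact hK
  | succ m ih => exact steinerSymmetral_subset_closedBall (hu _ (by omega)) ih

theorem Set.Nonempty.iteratedSymmetral (hu : ∀ m ≥ 1, ‖u m‖ = 1) (hK : K.Nonempty) (m : ℕ) :
    (iteratedSymmetral u K m).Nonempty := by
  induction m with
  | zero => exact hK
  | succ m ih => exact ih.steinerSymmetral (hu _ (by omega))

theorem IsCompact.iteratedSymmetral (hu : ∀ m ≥ 1, ‖u m‖ = 1) (hK : IsCompact K) (m : ℕ) :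
    IsCompact (iteratedSymmetral u K m) := by
  induction m with
  | zero => exact hK
  | succ m ih => exact ih.steinerSymmetral (hu _ (by omega))

theorem volume_iteratedSymmetral (hu : ∀ m ≥ 1, ‖u m‖ = 1) (hK : IsCompact K) (m : ℕ) :
    volume (iteratedSymmetral u K m) = volume K := by
  induction m with
  | zero => rfl
  | succ m ih =>
    exact (volume_steinerSymmetral (hu _ (by omega)) (hK.iteratedSymmetral hu m)).trans ih

theorem cthickening_iteratedSymmetral_subset (hu : ∀ m ≥ 1, ‖u m‖ = 1) (hK : IsCompact K) {δ : ℝ}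
    (hδ : 0 ≤ δ) (m : ℕ) :
    cthickening δ (iteratedSymmetral u K m) ⊆ iteratedSymmetral u (cthickening δ K) m := by
  induction m with
  | zero => exact subset_rfl
  | succ m ih =>
    exact (cthickening_steinerSymmetral_subset (hu _ (by omega)) (hK.iteratedSymmetral hu m)
      hδ).trans (steinerSymmetral_mono ih)

theorem hyperplaneFoot_add_smul_mem_iteratedSymmetral (hu : ∀ m ≥ 1, ‖u m‖ = 1) {m : ℕ}
    (hm : 1 ≤ m) {x : EuclideanSpace ℝ (Fin n)} (hx : x ∈ iteratedSymmetral u K m) {t : ℝ}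
    (ht : |t| ≤ |⟪u m, x⟫_ℝ|) :
    hyperplaneFoot (u m) x + t • u m ∈ iteratedSymmetral u K m := by
  obtain ⟨j, rfl⟩ := Nat.exists_eq_add_of_le' hm
  refine (add_smul_mem_steinerSymmetral (hu _ hm) (inner_hyperplaneFoot (hu _ hm) x) t).2
    ⟨hx.1, le_trans (ENNReal.ofReal_le_ofReal ?_) hx.2⟩
  linarith

/-- Past a certain index, a paraboloidal region that contains an iterated symmetral has only to be
raised by `η` to contain all later ones, up to rotation. -/
theorem exists_forall_iteratedSymmetral_subset_paraboloidRegion (hu : ∀ m ≥ 1, ‖u m‖ = 1)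
    (hpos : ∀ m ≥ 1, 0 < ⟪u m, u (m + 1)⟫_ℝ)
    (hsum : Summable fun m => 1 - ⟪u m, u (m + 1)⟫_ℝ ^ 2) {r C B η : ℝ} (hr : 0 ≤ r) (hC : 0 ≤ C)
    (hB : 0 ≤ B) (hη : 0 < η) (hK : K ⊆ closedBall 0 r) :
    ∃ M ≥ 1, ∀ p : EuclideanSpace ℝ (Fin n), ‖p‖ ≤ r → ∀ β, β + η ≤ B → ∀ m ≥ M,
      iteratedSymmetral u K m ⊆ paraboloidRegion (u m) ((aligningRotation u m).symm p) C β →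
      ∀ m' ≥ m, iteratedSymmetral u K m' ⊆
        paraboloidRegion (u m') ((aligningRotation u m').symm p) C (β + η) := by
  obtain ⟨k, hk, ε, hε, hstep⟩ :=
    exists_steinerSymmetral_subset_paraboloidRegion (n := n) hr hC hB
  set σ : ℕ → ℝ := fun m => 1 - ⟪u m, u (m + 1)⟫_ℝ ^ 2
  obtain ⟨M₁, hM₁⟩ := Metric.cauchySeq_iff.1 hsum.hasSum.tendsto_sum_nat.cauchySeq (η / (k + 1))
    (by positivity)
  obtain ⟨M₂, hM₂⟩ := eventually_atTop.1
    (hsum.tendsto_atTop_zero.eventually (Iic_mem_nhds hε))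
  refine ⟨max 1 (max M₁ M₂), le_max_left _ _, fun p hp β hβ m hm hsub m' hm' => ?_⟩
  have hm1 : 1 ≤ m := le_of_max_le_left hm
  have hmM₁ : M₁ ≤ m := (le_max_left _ _).trans (le_of_max_le_right hm)
  have hmM₂ : M₂ ≤ m := (le_max_right _ _).trans (le_of_max_le_right hm)
  set s : ℕ → ℝ := fun j => ∑ i ∈ Finset.range j, σ i
  have hs : ∀ j ≥ m, k * (s j - s m) ≤ η := fun j hj => by
    have h2 : |s j - s m| * (k + 1) ≤ η := by
      have := (hM₁ j (hmM₁.trans hj) m hmM₁).le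
      rwa [Real.dist_eq, le_div_iff₀ (by positivity)] at this
    linarith [abs_nonneg (s j - s m),
      mul_le_mul_of_nonneg_left (le_abs_self (s j - s m)) hk]
  have key : ∀ j ≥ m, iteratedSymmetral u K j ⊆
      paraboloidRegion (u j) ((aligningRotation u j).symm p) C (β + k * (s j - s m)) := by
    intro j hj
    induction j, hj using Nat.le_induction with
    | base => simpa using hsub
    | succ j hj ih =>
      have hj1 : 1 ≤ j := hm1.trans hj
      have h1 := hstep (u j) (u (j + 1)) ((aligningRotation u j).symm p) (hu j hj1)
        (hu _ (by omega)) (by rwa [LinearIsometryEquiv.norm_map]) (hpos j hj1)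
        (hM₂ j (hmM₂.trans hj)) _ (by linarith [hs j hj]) _
        (iteratedSymmetral_subset_closedBall hu hK j) ih
      have h2 : s (j + 1) = s j + σ j := Finset.sum_range_succ _ _
      have h3 : β + k * (s (j + 1) - s m) = β + k * (s j - s m) + k * σ j := by rw [h2]; ring
      rw [aligningRotation_succ hj1, h3]
      exact h1
  exact (key m' hm').trans (paraboloidRegion_mono (by linarith [hs m' hm']))

/-- If a late aligned symmetral stays away from a point, then so do all the later ones. -/
theorem exists_forall_le_dist_aligned_iteratedSymmetral (hu : ∀ m ≥ 1, ‖u m‖ = 1)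
    (hpos : ∀ m ≥ 1, 0 < ⟪u m, u (m + 1)⟫_ℝ)
    (hsum : Summable fun m => 1 - ⟪u m, u (m + 1)⟫_ℝ ^ 2) (hK : Bornology.IsBounded K)
    (x : EuclideanSpace ℝ (Fin n)) {η : ℝ} (hη : 0 < η) :
    ∃ ε > 0, ∃ M, ∀ m ≥ M,
      (∀ z ∈ aligningRotation u m '' iteratedSymmetral u K m, η ≤ dist z x) →
      ∀ m' ≥ m, ∀ z ∈ aligningRotation u m' '' iteratedSymmetral u K m', ε ≤ dist z x := by
  obtain ⟨η, rfl⟩ : ∃ η', η = 2 * η' := ⟨η / 2, by ring⟩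
  replace hη : 0 < η := by linarith
  obtain ⟨r₀, hr₀⟩ := hK.subset_closedBall 0
  set r := max r₀ ‖x‖
  have hr : 0 ≤ r := (norm_nonneg x).trans (le_max_right _ _)
  have hKr : K ⊆ closedBall 0 r := hr₀.trans (closedBall_subset_closedBall (le_max_left _ _))
  set e := u 1
  have he : ‖e‖ = 1 := hu 1 le_rfl
  set p := hyperplaneFoot e x
  have hpr : ‖p‖ ≤ r := (norm_hyperplaneFoot_le he x).trans (le_max_right _ _)
  have hxp : p + ⟪e, x⟫_ℝ • e = x := hyperplaneFoot_add_inner_smul x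
  -- with this coefficient the barrier rises above the ball of radius `r` at distance `η` from its axis
  set C := (r + η) / η ^ 2 with hCdef
  have hC : 0 ≤ C := by positivity
  have hCη : C * η ^ 2 = r + η := by rw [hCdef]; field_simp
  obtain ⟨M, hM1, hM⟩ := exists_forall_iteratedSymmetral_subset_paraboloidRegion hu hpos hsum hr hC
    (abs_nonneg ⟪e, x⟫_ℝ) (half_pos hη) hKr
  refine ⟨min 1 (η / (2 * (1 + C))), by positivity, M, fun m hm hfar m' hm' => ?_⟩
  have hRe : ∀ j ≥ 1, aligningRotation u j (u j) = e := fun j hj =>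
    aligningRotation_apply hu hpos hj
  have hinner : ∀ j ≥ 1, ∀ z, ⟪u j, z⟫_ℝ = ⟪e, aligningRotation u j z⟫_ℝ := fun j hj z => by
    rw [← hRe j hj, LinearIsometryEquiv.inner_map_map]
  have hfoot : ∀ j ≥ 1, ∀ z, aligningRotation u j (hyperplaneFoot (u j) z) =
      hyperplaneFoot e (aligningRotation u j z) := fun j hj z => by
    rw [hyperplaneFoot, hyperplaneFoot, map_sub, map_smul, hRe j hj,
      hinner j hj]
  have hm1 : 1 ≤ m := hM1.trans hm
  have hsub : iteratedSymmetral u K m ⊆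
      paraboloidRegion (u m) ((aligningRotation u m).symm p) C (|⟪e, x⟫_ℝ| - η) := by
    intro z hz
    by_contra hcon
    simp only [paraboloidRegion, mem_ofPred_eq, not_le] at hcon
    set d := ‖hyperplaneFoot (u m) z - (aligningRotation u m).symm p‖ with hd
    have hd0 : 0 ≤ d := norm_nonneg _
    have hz1 : |⟪u m, z⟫_ℝ| ≤ r := (abs_inner_le_norm_of_unit (hu m hm1) z).trans
      (by simpa using iteratedSymmetral_subset_closedBall hu hKr m hz)
    have hdη : d < η := by
      by_contra! hle
      have := mul_le_mul_of_nonneg_left (pow_le_pow_left₀ hη.le hle 2) hC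
      linarith [abs_nonneg ⟪e, x⟫_ℝ]
    have hheight : |⟪e, x⟫_ℝ| - η < |⟪u m, z⟫_ℝ| := by
      have : 0 ≤ C * d ^ 2 := by positivity
      linarith
    -- the point of the section through `z` whose height is closest to that of `x`
    obtain ⟨t, ht, htx⟩ : ∃ t, |t| ≤ |⟪u m, z⟫_ℝ| ∧ |t - ⟪e, x⟫_ℝ| < η := by
      have ha := abs_nonneg ⟪u m, z⟫_ℝ
      generalize |⟪u m, z⟫_ℝ| = a, ⟪e, x⟫_ℝ = b at *
      rcases le_total |b| a with hba | hab
      · exact ⟨b, hba, by simpa using hη⟩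
      · rcases le_total 0 b with hb | hb
        · rw [abs_of_nonneg hb] at *
          exact ⟨a, (abs_of_nonneg ha).le, by rw [abs_lt]; constructor <;> linarith⟩
        · rw [abs_of_nonpos hb] at *
          exact ⟨-a, by rw [abs_neg, abs_of_nonneg ha],
            by rw [abs_lt]; constructor <;> linarith⟩
    have hmem := hyperplaneFoot_add_smul_mem_iteratedSymmetral hu hm1 hz ht
    have hdist := hfar _ (mem_image_of_mem _ hmem)
    rw [map_add, map_smul, hRe m hm1, dist_eq_norm] at hdist
    have h1 : aligningRotation u m (hyperplaneFoot (u m) z) + t • e - x =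
        aligningRotation u m (hyperplaneFoot (u m) z - (aligningRotation u m).symm p) +
          (t - ⟪e, x⟫_ℝ) • e := by
      nth_rewrite 1 [← hxp]
      rw [map_sub, LinearIsometryEquiv.apply_symm_apply]
      module
    have h2 := norm_add_le (aligningRotation u m
      (hyperplaneFoot (u m) z - (aligningRotation u m).symm p)) ((t - ⟪e, x⟫_ℝ) • e)
    rw [LinearIsometryEquiv.norm_map, norm_smul, he, Real.norm_eq_abs, ← h1] at h2
    linarith
  have hlater := hM p hpr (|⟪e, x⟫_ℝ| - η) (by linarith) m hm hsub m' hm'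
  rintro _ ⟨z, hz, rfl⟩
  have hm1' : 1 ≤ m' := hm1.trans hm'
  have h1 := hlater hz
  simp only [paraboloidRegion, mem_ofPred_eq] at h1
  rw [← LinearIsometryEquiv.norm_map (aligningRotation u m'), map_sub, hfoot m' hm1',
    LinearIsometryEquiv.apply_symm_apply, hinner m' hm1', ← hyperplaneFoot_sub] at h1
  set w := aligningRotation u m' z
  have h2 : ‖hyperplaneFoot e (w - x)‖ ≤ dist w x := by
    rw [dist_eq_norm]; exact norm_hyperplaneFoot_le he _
  have h3 : |⟪e, x⟫_ℝ| - |⟪e, w⟫_ℝ| ≤ dist w x := by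
    refine (abs_sub_abs_le_abs_sub _ _).trans ?_
    rw [← inner_sub_right, dist_comm, dist_eq_norm]
    exact abs_inner_le_norm_of_unit he _
  by_contra! hlt
  obtain ⟨h4, h5⟩ := lt_min_iff.1 hlt
  rw [lt_div_iff₀ (by positivity)] at h5
  have h6 : C * ‖hyperplaneFoot e (w - x)‖ ^ 2 ≤ C * dist w x := by
    refine mul_le_mul_of_nonneg_left ?_ hC
    nlinarith [norm_nonneg (hyperplaneFoot e (w - x)), dist_nonneg (x := w) (y := x)]
  linarith

end Iterated

/-- The sine of the angle between consecutive directions is square summable with the angle. -/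
theorem summable_one_sub_inner_sq {n : ℕ} {u : ℕ → EuclideanSpace ℝ (Fin n)} {α : ℕ → ℝ}
    (hcos : ∀ m ≥ 1, ⟪u m, u (m + 1)⟫_ℝ = Real.cos (α (m + 1)))
    (hsum : Summable fun m => α m ^ 2) : Summable fun m => 1 - ⟪u m, u (m + 1)⟫_ℝ ^ 2 := by
  rw [← summable_nat_add_iff 1]
  have h : ∀ m, 1 - ⟪u (m + 1), u (m + 1 + 1)⟫_ℝ ^ 2 = Real.sin (α (m + 2)) ^ 2 := fun m => by
    rw [hcos (m + 1) (by omega), Real.sin_sq]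
  simp only [h]
  refine ((summable_nat_add_iff 2).2 hsum).of_nonneg_of_le (fun m => sq_nonneg _) fun m => ?_
  rw [← sq_abs, ← sq_abs (α (m + 2))]
  exact pow_le_pow_left₀ (abs_nonneg _) Real.abs_sin_le_abs 2

theorem theorem2p1 {n : ℕ} (u : ℕ → EuclideanSpace ℝ (Fin n)) (α : ℕ → ℝ)
    (hu : ∀ m ≥ 1, ‖u m‖ = 1)
    (hα : ∀ m ≥ 1, α (m + 1) ∈ Set.Ioo 0 (Real.pi / 2))
    (hcos : ∀ m ≥ 1, ⟪u m, u (m + 1)⟫_ℝ = Real.cos (α (m + 1)))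
    (hsum : Summable fun m => α m ^ 2) :
    ∃ R : ℕ → (EuclideanSpace ℝ (Fin n) ≃ₗᵢ[ℝ] EuclideanSpace ℝ (Fin n)),
      (∀ m, IsRotation (R m)) ∧
      ∀ K : Set (EuclideanSpace ℝ (Fin n)), IsCompact K → K.Nonempty →
        ∃ L : Set (EuclideanSpace ℝ (Fin n)), IsCompact L ∧ L.Nonempty ∧
          Filter.Tendsto (fun m => Metric.hausdorffEDist (R m '' iteratedSymmetral u K m) L)
            Filter.atTop (𝓝 0) ∧
          Filter.Tendsto
            (fun m => MeasureTheory.volume ((R m '' iteratedSymmetral u K m) ∆ L))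
            Filter.atTop (𝓝 0) := by
  have hpos : ∀ m ≥ 1, 0 < ⟪u m, u (m + 1)⟫_ℝ := fun m hm => by
    rw [hcos m hm]
    exact Real.cos_pos_of_mem_Ioo ⟨by linarith [(hα m hm).1, Real.pi_pos], (hα m hm).2⟩
  refine ⟨aligningRotation u, isRotation_aligningRotation hu hpos, fun K hK hne => ?_⟩
  obtain ⟨r, hr⟩ := hK.isBounded.subset_closedBall 0
  have hvol : ∀ m (S : Set (EuclideanSpace ℝ (Fin n))),
      volume (aligningRotation u m '' S) = volume S := fun m S => by
    rw [LinearIsometryEquiv.image_eq_preimage_symm]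
    exact (aligningRotation u m).symm.measurePreserving.measure_preimage_equiv
      (f := (aligningRotation u m).symm.toMeasurableEquiv) S
  obtain ⟨L, hL, hLne, hlim⟩ := exists_tendsto_hausdorffEDist_of_forall_le_dist
    (A := fun m => aligningRotation u m '' iteratedSymmetral u K m)
    (isCompact_closedBall (0 : EuclideanSpace ℝ (Fin n)) r)
    (fun m => by
      rintro _ ⟨z, hz, rfl⟩
      simpa using iteratedSymmetral_subset_closedBall hu hr m hz)
    (fun m => (hne.iteratedSymmetral hu m).image _)
    (fun x η hη => exists_forall_le_dist_aligned_iteratedSymmetral hu hpos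
      (summable_one_sub_inner_sq hcos hsum) hK.isBounded x hη)
  refine ⟨L, hL, hLne, hlim, tendsto_measure_symmDiff_of_tendsto_hausdorffEDist volume
    (fun m => (hK.iteratedSymmetral hu m).image (aligningRotation u m).continuous) hK hL
    (fun m => by rw [hvol, volume_iteratedSymmetral hu hK]) (fun m δ hδ => ?_) hlim⟩
  have hsub : cthickening δ (aligningRotation u m '' iteratedSymmetral u K m) ⊆
      aligningRotation u m '' iteratedSymmetral u (cthickening δ K) m := fun z hz => by
    refine ⟨(aligningRotation u m).symm z,
      cthickening_iteratedSymmetral_subset hu hK hδ.le m ?_, by simp⟩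
    rw [mem_cthickening_iff] at hz ⊢
    rwa [← infEDist_image (aligningRotation u m).isometry, LinearIsometryEquiv.apply_symm_apply]
  refine (measure_mono hsub).trans ?_
  rw [hvol, volume_iteratedSymmetral hu hK.cthickening]
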